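/- For a normed space $X$ over ${\bf K}\in\{{\bf R},{\bf C}\}$ with dual $X^*$ and for $n\in{\bf N}$ let $$c_n(X):=\inf\Big\{M : \prod_{j=1}^n\|f_j\|\le M\,\Big\|\prod_{j=1}^n f_j\Big\|\ \ (\forall f_1,\dots,f_n\in X^*)\Big\},\qquad \Big\|\prod_{j=1}^n f_j\Big\|:=\sup_{\|x\|\le 1}\Big|\prod_{j=1}^n f_j(x)\Big|,$$ be the $n$-th linear polarization constant of $X$, and let $c(X):=\lim_{n\to\infty}c_n(X)^{1/n}\in[0,\infty]$ be its linear polarization constant. Let $d\ge 1$, let ${\bf C}^d$ carry its standard Hilbert space structure, let $\sigma$ be the normalized surface measure on the unit sphere $S$ of ${\bf C}^d$, and for $s\in S$ put $$L(d,{\bf C}):=\int_S\log|\langle x,s\rangle|\,d\sigma(x).$$ Theorem (Pappas, Révész). For every $d\ge1$ and every $s\in S$, the function $x\mapsto\log|\langle x,s\rangle|$ is $\sigma$-integrable on $S$, the limit defining $c({\bf C}^d)$ exists, and $$c({\bf C}^d)=e^{-L(d,{\bf C})}.$$ (In particular, $L(d,{\bf C})$ does not depend on the choice of $s$.) -/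

import Mathlib

open MeasureTheory Filter Topology
open scoped ENNReal

/-- The norm of the `n`-homogeneous polynomial `x ↦ ∏ j, f j x`, that is, the supremum of its
modulus over the closed unit ball of `X`, as an extended nonnegative number. -/
noncomputable def prodFunctionalNorm {𝕜 : Type*} [RCLike 𝕜] {X : Type*} [NormedAddCommGroup X]
    [NormedSpace 𝕜 X] {n : ℕ} (f : Fin n → StrongDual 𝕜 X) : ℝ≥0∞ :=
  ⨆ x ∈ Metric.closedBall (0 : X) 1, ‖∏ j, f j x‖ₑ

/-- The `n`-th (linear) polarization constant `c_n(X)`: the infimum of all `M` such that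
`∏ ‖f j‖ ≤ M ‖∏ f j‖` for all continuous linear functionals `f 0, …, f (n - 1)` on `X`. -/
noncomputable def nthPolarizationConstant (𝕜 : Type*) [RCLike 𝕜] (X : Type*)
    [NormedAddCommGroup X] [NormedSpace 𝕜 X] (n : ℕ) : ℝ≥0∞ :=
  sInf {M : ℝ≥0∞ | ∀ f : Fin n → StrongDual 𝕜 X, ∏ j, ‖f j‖ₑ ≤ M * prodFunctionalNorm f}

/-- `c` is the linear polarization constant of `X`: the limit of `c_n(X) ^ (1 / n)` exists in
`[0, ∞]` and equals `c`. -/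
def IsLinearPolarizationConstant (𝕜 : Type*) [RCLike 𝕜] (X : Type*)
    [NormedAddCommGroup X] [NormedSpace 𝕜 X] (c : ℝ≥0∞) : Prop :=
  Tendsto (fun n : ℕ => nthPolarizationConstant 𝕜 X n ^ (1 / (n : ℝ))) atTop (𝓝 c)

/-- The normalized surface measure on the unit sphere of `ℂ^d`. -/
noncomputable def normalizedSurfaceMeasure (d : ℕ) :
    Measure (Metric.sphere (0 : EuclideanSpace ℂ (Fin d)) 1) :=
  ((volume : Measure (EuclideanSpace ℂ (Fin d))).toSphere Set.univ)⁻¹ •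
    (volume : Measure (EuclideanSpace ℂ (Fin d))).toSphere

/-- `L(d, ℂ)`: the integral of `x ↦ log |⟨x, s⟩|` over the unit sphere of `ℂ^d` with respect to
normalized surface measure, computed with the unit vector `s`. -/
noncomputable def sphereLogMean (d : ℕ)
    (s : Metric.sphere (0 : EuclideanSpace ℂ (Fin d)) 1) : ℝ :=
  ∫ x, Real.log ‖inner ℂ (x : EuclideanSpace ℂ (Fin d)) (s : EuclideanSpace ℂ (Fin d))‖
    ∂(normalizedSurfaceMeasure d)

/-!
Write `k(x, s) = |⟨x, s⟩|` on the unit sphere of `ℂ^d`.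

Integrability of `log k(·, s)`. Surface measure is invariant under unitary maps, which act
transitively on the sphere (`exists_measurePreserving_inner_eq`), so `s` may be taken to be a
coordinate vector, and the mean `L` of `log k(·, s)` does not depend on `s`. The integral over the
sphere is then dominated by one over the unit ball
(`integrable_toSphere_of_integrableOn_ball`), where `log (|x₀| / ‖x‖)` is controlled by
`log |x₀|` and `log ‖x‖`, both integrable in polar coordinates.

Upper bound `c_n ≤ e^{-nL}` (`nthPolarizationConstant_le`). Every nonzero functional on `ℂ^d` has
modulus `‖f‖ k(·, t)` for some unit vector `t`, so `log |∏ f_j|` has mean `∑ log ‖f_j‖ + n L` over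
the sphere, and the supremum is at least the mean.

Lower bound (`eventually_le_nthPolarizationConstant`). Given `a > L`, the bounded kernel
`log (max k δ)` still has mean less than `a` for small `δ > 0`. It is continuous on the product of
two spheres, so it defines a continuous map from the sphere to a Banach space of continuous
functions; the strong law of large numbers in that space gives unit vectors `u_0, u_1, …` whose
empirical means of the kernel converge to its mean uniformly in `x` (`exists_seq_uniform_average`).
Hence `∏_{i<n} |⟨x, u_i⟩| ≤ e^{na}` on the ball for all large `n`, that is, `c_n ≥ e^{-na}`.
Taking `n`-th roots and letting `a` decrease to `L` gives the limit.
-/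

/-! ### Surface measure and linear isometries -/

section Sphere

open scoped Pointwise

variable {E : Type*} [NormedAddCommGroup E]

/-- The self-map of the unit sphere induced by a real linear isometry. -/
def sphereMap [NormedSpace ℝ E] (e : E ≃ₗᵢ[ℝ] E) (x : Metric.sphere (0 : E) 1) :
    Metric.sphere (0 : E) 1 :=
  ⟨e x, by simp⟩

lemma continuous_sphereMap [NormedSpace ℝ E] (e : E ≃ₗᵢ[ℝ] E) : Continuous (sphereMap e) :=
  (e.continuous.comp continuous_subtype_val).subtype_mk _

lemma injective_sphereMap [NormedSpace ℝ E] (e : E ≃ₗᵢ[ℝ] E) :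
    Function.Injective (sphereMap e) := fun _ _ h ↦
  Subtype.ext (e.injective (congrArg Subtype.val h))

lemma preimage_Ioo_smul_sphere [NormedSpace ℝ E] (e : E ≃ₗᵢ[ℝ] E)
    (t : Set (Metric.sphere (0 : E) 1)) :
    Set.Ioo (0 : ℝ) 1 • (Subtype.val '' (sphereMap e ⁻¹' t)) =
      e ⁻¹' (Set.Ioo (0 : ℝ) 1 • (Subtype.val '' t)) := by
  ext x
  simp only [Set.mem_smul, Set.mem_image, Set.mem_preimage]
  constructor
  · rintro ⟨r, hr, _, ⟨y, hy, rfl⟩, rfl⟩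
    exact ⟨r, hr, _, ⟨_, hy, rfl⟩, by simp [sphereMap]⟩
  · rintro ⟨r, hr, _, ⟨y, hy, rfl⟩, h⟩
    refine ⟨r, hr, e.symm y, ⟨⟨e.symm y, by simp⟩, ?_, rfl⟩, ?_⟩
    · simpa [sphereMap] using hy
    · rw [← map_smul, h, e.symm_apply_apply]

variable [MeasurableSpace E] [BorelSpace E]

lemma measurePreserving_toSphere_sphereMap [NormedSpace ℝ E] {μ : Measure E} (e : E ≃ₗᵢ[ℝ] E)
    (he : MeasurePreserving e μ μ) :
    MeasurePreserving (sphereMap e) μ.toSphere μ.toSphere := by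
  refine ⟨(continuous_sphereMap e).measurable, ?_⟩
  ext t ht
  have hm := (continuous_sphereMap e).measurable
  rw [Measure.map_apply hm ht, μ.toSphere_apply' (hm ht), μ.toSphere_apply' ht,
    preimage_Ioo_smul_sphere]
  congr 1
  exact he.measure_preimage_emb e.toHomeomorph.measurableEmbedding _

/-- A function on the sphere is integrable as soon as its radial extension is integrable on the
unit ball. -/
lemma integrable_toSphere_of_integrableOn_ball [NormedSpace ℝ E] [FiniteDimensional ℝ E]
    [Nontrivial E] (μ : Measure E) [μ.IsAddHaarMeasure] {f : Metric.sphere (0 : E) 1 → ℝ}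
    {g : E → ℝ} (hg : IntegrableOn g (Metric.ball 0 1) μ)
    (hfg : ∀ x : ({0}ᶜ : Set E), f (homeomorphUnitSphereProd E x).1 = g x) :
    Integrable f μ.toSphere := by
  have hmp := (μ.measurePreserving_homeomorphUnitSphereProd).restrict_preimage
    (s := Set.univ ×ˢ Set.Iio ⟨1, Set.mem_Ioi.2 one_pos⟩)
    (MeasurableSet.univ.prod measurableSet_Iio)
  rw [← Measure.prod_restrict, Measure.restrict_univ] at hmp
  set ν := (Measure.volumeIoiPow (Module.finrank ℝ E - 1)).restrict
    (Set.Iio ⟨1, Set.mem_Ioi.2 one_pos⟩) with hν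
  have hνu : ν Set.univ = ENNReal.ofReal (1 / ((Module.finrank ℝ E - 1 : ℕ) + 1)) := by
    simp [hν, Measure.volumeIoiPow_apply_Iio]
  have : IsFiniteMeasure ν := ⟨by rw [hνu]; exact ENNReal.ofReal_lt_top⟩
  have hν0 : ν ≠ 0 := by
    rw [← Measure.measure_univ_ne_zero, hνu]
    simp only [ne_eq, ENNReal.ofReal_eq_zero, not_le]
    positivity
  rw [← Integrable.comp_fst_iff (μ := μ.toSphere) hν0,
    ← hmp.integrable_comp_emb (Homeomorph.measurableEmbedding _)]
  have hpre : (homeomorphUnitSphereProd E) ⁻¹' (Set.univ ×ˢ Set.Iio ⟨1, Set.mem_Ioi.2 one_pos⟩) =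
      Subtype.val ⁻¹' (Metric.ball (0 : E) 1) := by
    ext x
    simp [← Subtype.coe_lt_coe]
  have hcomp : ((fun x : Metric.sphere (0 : E) 1 × Set.Ioi (0 : ℝ) ↦ f x.1) ∘
      homeomorphUnitSphereProd E) = g ∘ Subtype.val := funext hfg
  have hemb : MeasurableEmbedding (Subtype.val : ({0}ᶜ : Set E) → E) :=
    MeasurableEmbedding.subtype_coe (measurableSet_singleton _).compl
  rw [hcomp, hpre, ← hemb.integrable_map_iff, ← hemb.restrict_map, hemb.map_comap,
    Measure.restrict_restrict Metric.isOpen_ball.measurableSet]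
  exact hg.mono_set Set.inter_subset_left

lemma toSphere_setOf_mem_submodule [NormedSpace ℝ E] [FiniteDimensional ℝ E]
    (μ : Measure E) [μ.IsAddHaarMeasure] (p : Submodule ℝ E) (hp : p ≠ ⊤) :
    μ.toSphere {x : Metric.sphere (0 : E) 1 | (x : E) ∈ p} = 0 := by
  have hm : MeasurableSet {x : Metric.sphere (0 : E) 1 | (x : E) ∈ p} :=
    (p.closed_of_finiteDimensional.preimage continuous_subtype_val).measurableSet
  rw [μ.toSphere_apply' hm]
  refine mul_eq_zero_of_right _ (measure_mono_null ?_ (μ.addHaar_submodule p hp))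
  rintro _ ⟨r, -, _, ⟨y, hy, rfl⟩, rfl⟩
  exact p.smul_mem r hy

/-- The logarithm of the norm is locally integrable at the origin in positive dimension. -/
lemma integrableOn_log_norm_ball [NormedSpace ℝ E] [FiniteDimensional ℝ E] [Nontrivial E]
    (μ : Measure E) [μ.IsAddHaarMeasure] :
    IntegrableOn (fun x ↦ Real.log ‖x‖) (Metric.ball 0 1) μ := by
  rw [integrableOn_fun_norm_addHaar]
  have h : IntegrableOn Real.log (Set.Ioo 0 1) :=
    ((intervalIntegrable_iff_integrableOn_Ioo_of_le zero_le_one).1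
      intervalIntegral.intervalIntegrable_log')
  refine h.norm.mono' (by fun_prop) ?_
  filter_upwards [ae_restrict_mem measurableSet_Ioo] with y hy
  rw [norm_smul]
  refine mul_le_of_le_one_left (norm_nonneg _) ?_
  rw [norm_pow, Real.norm_of_nonneg hy.1.le]
  exact pow_le_one₀ hy.1.le hy.2.le

end Sphere


/-! ### Uniformly equidistributed sequences -/

/-- For a continuous kernel on compact spaces some sequence of points makes the empirical means of
the kernel converge to its mean uniformly in the other variable. A random sequence of independent
points works almost surely, by the strong law of large numbers in the Banach space `C(T, ℝ)`. -/
lemma exists_seq_uniform_average {S T : Type*} [TopologicalSpace S] [CompactSpace S]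
    [SecondCountableTopology S] [MeasurableSpace S] [BorelSpace S] [TopologicalSpace T]
    [CompactSpace T] (σ : Measure S) [IsProbabilityMeasure σ] (g : C(S × T, ℝ)) :
    ∃ u : ℕ → S, ∀ ε > 0, ∀ᶠ n : ℕ in atTop, ∀ t : T,
      |(n : ℝ)⁻¹ * ∑ i ∈ Finset.range n, g (u i, t) - ∫ s, g (s, t) ∂σ| < ε := by
  borelize C(T, ℝ)
  have hG : Continuous g.curry := g.curry.continuous
  have hGi : Integrable g.curry σ :=
    hG.integrable_of_hasCompactSupport (HasCompactSupport.of_compactSpace _)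
  let P : Measure (ℕ → S) := Measure.infinitePi fun _ ↦ σ
  have hmp (i : ℕ) : MeasurePreserving (fun ω : ℕ → S ↦ ω i) P σ :=
    measurePreserving_eval_infinitePi (fun _ ↦ σ) i
  have hid (i : ℕ) : ProbabilityTheory.IdentDistrib (fun ω : ℕ → S ↦ g.curry (ω i))
      (fun ω ↦ g.curry (ω 0)) P P := by
    have h : ProbabilityTheory.IdentDistrib (fun ω : ℕ → S ↦ ω i) (fun ω ↦ ω 0) P P :=
      ⟨(hmp i).measurable.aemeasurable, (hmp 0).measurable.aemeasurable,
        (hmp i).map_eq.trans (hmp 0).map_eq.symm⟩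
    exact h.comp hG.measurable
  have hind : Pairwise (Function.onFun
      (fun X Y ↦ ProbabilityTheory.IndepFun X Y P) fun i (ω : ℕ → S) ↦ g.curry (ω i)) :=
    fun i j hij ↦ (ProbabilityTheory.iIndepFun_infinitePi (P := fun _ : ℕ ↦ σ)
      (X := fun _ ↦ g.curry) fun _ ↦ hG.measurable).indepFun hij
  have hlaw := ProbabilityTheory.strong_law_ae (fun i (ω : ℕ → S) ↦ g.curry (ω i))
    ((hmp 0).integrable_comp_of_integrable hGi) hind hid
  obtain ⟨u, hu⟩ := hlaw.exists
  refine ⟨u, fun ε hε ↦ ?_⟩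
  have hmean (t : T) : (∫ ω, g.curry (ω 0) ∂P) t = ∫ s, g (s, t) ∂σ := by
    have h1 := (ContinuousMap.evalCLM ℝ t).integral_comp_comm
      ((hmp 0).integrable_comp_of_integrable hGi)
    have h2 : ∫ ω, g (ω 0, t) ∂P = ∫ s, g (s, t) ∂σ := by
      rw [← (hmp 0).map_eq, integral_map (hmp 0).measurable.aemeasurable]
      exact (g.continuous.comp (by fun_prop)).aestronglyMeasurable
    exact h1.symm.trans h2
  filter_upwards [Metric.tendsto_nhds.1 hu ε hε] with n hn t
  have := (ContinuousMap.dist_apply_le_dist t).trans_lt hn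
  rwa [hmean, Real.dist_eq, ContinuousMap.smul_apply, ContinuousMap.sum_apply] at this

/-! ### Unitary invariance of the normalized surface measure -/

section ComplexSphere

variable {d : ℕ}

/-- The unit sphere of `ℂ^d`. -/
local notation "𝕊" d => Metric.sphere (0 : EuclideanSpace ℂ (Fin d)) 1

instance isProbabilityMeasure_normalizedSurfaceMeasure [NeZero d] :
    IsProbabilityMeasure (normalizedSurfaceMeasure d) := by
  refine ⟨?_⟩
  rw [normalizedSurfaceMeasure, Measure.smul_apply, smul_eq_mul]
  refine ENNReal.inv_mul_cancel ?_ (measure_ne_top _ _)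
  rw [Measure.measure_univ_ne_zero]
  exact Measure.toSphere_ne_zero _

lemma exists_linearIsometryEquiv_map_eq (s t : 𝕊 d) :
    ∃ e : EuclideanSpace ℂ (Fin d) ≃ₗᵢ[ℂ] EuclideanSpace ℂ (Fin d), e s = t := by
  have key (u : 𝕊 d) (i : Fin d) :
      ∃ b : OrthonormalBasis (Fin d) ℂ (EuclideanSpace ℂ (Fin d)), b i = u := by
    obtain ⟨b, hb⟩ := Orthonormal.exists_orthonormalBasis_extension_of_card_eq (𝕜 := ℂ)
      (E := EuclideanSpace ℂ (Fin d)) (ι := Fin d) (by simp) (v := fun _ ↦ (u : EuclideanSpace ℂ _))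
      (s := {i}) ⟨fun _ ↦ by simp, fun a b hab ↦ (hab (Subsingleton.elim a b)).elim⟩
    exact ⟨b, hb i rfl⟩
  rcases Nat.eq_zero_or_pos d with rfl | hd
  · exact ⟨.refl ℂ _, Subsingleton.elim _ _⟩
  · obtain ⟨b, hb⟩ := key s ⟨0, hd⟩
    obtain ⟨c, hc⟩ := key t ⟨0, hd⟩
    exact ⟨b.equiv c (Equiv.refl _), by rw [← hb, ← hc]; simp⟩

/-- The unitary group acts transitively on the sphere and preserves surface measure: some
measure preserving self-embedding `T` of the sphere comes from a unitary map carrying `s` to `t`. -/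
lemma exists_measurePreserving_inner_eq (s t : 𝕊 d) :
    ∃ T : (𝕊 d) → (𝕊 d), MeasurableEmbedding T ∧
      MeasurePreserving T (normalizedSurfaceMeasure d) (normalizedSurfaceMeasure d) ∧
      ∀ x : 𝕊 d, inner ℂ (T x : EuclideanSpace ℂ (Fin d)) t =
        inner ℂ (x : EuclideanSpace ℂ (Fin d)) s := by
  obtain ⟨e, he⟩ := exists_linearIsometryEquiv_map_eq s t
  let e' : EuclideanSpace ℂ (Fin d) ≃ₗᵢ[ℝ] EuclideanSpace ℂ (Fin d) :=
    { toLinearEquiv := e.toLinearEquiv.restrictScalars ℝ, norm_map' := e.norm_map }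
  refine ⟨sphereMap e',
    ((continuous_sphereMap e').isClosedEmbedding (injective_sphereMap e')).measurableEmbedding,
    (measurePreserving_toSphere_sphereMap e' e'.measurePreserving).smul_measure _, fun x ↦ ?_⟩
  rw [← he]
  exact e.inner_map_map x s

lemma integral_norm_inner_eq (φ : ℝ → ℝ) (s t : 𝕊 d) :
    ∫ x : 𝕊 d, φ ‖inner ℂ (x : EuclideanSpace ℂ (Fin d)) (s : EuclideanSpace ℂ (Fin d))‖
        ∂(normalizedSurfaceMeasure d) =
      ∫ x : 𝕊 d, φ ‖inner ℂ (x : EuclideanSpace ℂ (Fin d)) (t : EuclideanSpace ℂ (Fin d))‖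
        ∂(normalizedSurfaceMeasure d) := by
  obtain ⟨T, hT, hT', h⟩ := exists_measurePreserving_inner_eq s t
  simpa only [h] using hT'.integral_comp hT fun x : 𝕊 d ↦
    φ ‖inner ℂ (x : EuclideanSpace ℂ (Fin d)) (t : EuclideanSpace ℂ (Fin d))‖

/-! ### Integrability of the logarithmic kernel -/

lemma ae_inner_ne_zero (s : 𝕊 d) : ∀ᵐ x : 𝕊 d ∂(normalizedSurfaceMeasure d),
    inner ℂ (x : EuclideanSpace ℂ (Fin d)) (s : EuclideanSpace ℂ (Fin d)) ≠ 0 := by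
  let p : Submodule ℝ (EuclideanSpace ℂ (Fin d)) :=
    (LinearMap.ker (innerSL ℂ (s : EuclideanSpace ℂ (Fin d))).toLinearMap).restrictScalars ℝ
  have hp (x : EuclideanSpace ℂ (Fin d)) :
      x ∈ p ↔ inner ℂ x (s : EuclideanSpace ℂ (Fin d)) = 0 := by
    rw [inner_eq_zero_symm]
    simp [p]
  have hs : (s : EuclideanSpace ℂ (Fin d)) ∉ p := by
    rw [hp, inner_self_eq_zero]
    exact ne_zero_of_mem_unit_sphere s
  have h0 : ∀ᵐ x : 𝕊 d ∂(volume : Measure (EuclideanSpace ℂ (Fin d))).toSphere,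
      (x : EuclideanSpace ℂ (Fin d)) ∉ p := by
    simpa [ae_iff] using toSphere_setOf_mem_submodule
      (volume : Measure (EuclideanSpace ℂ (Fin d))) p fun h ↦ hs (h ▸ Submodule.mem_top)
  exact Measure.ae_smul_measure (h0.mono fun x hx ↦ (hp x).not.1 hx) _

lemma integrableOn_log_norm_coord_ball (i : Fin d) :
    IntegrableOn (fun x : EuclideanSpace ℂ (Fin d) ↦ Real.log ‖x i‖) (Metric.ball 0 1) := by
  have h : Integrable (fun z : ℂ ↦ Real.log ‖z‖) (volume.restrict (Metric.ball 0 1)) :=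
    integrableOn_log_norm_ball volume
  have : IsFiniteMeasure ((volume : Measure ℂ).restrict (Metric.ball 0 1)) :=
    ⟨by simp⟩
  have h2 := integrable_comp_eval (μ := fun _ : Fin d ↦ volume.restrict (Metric.ball (0 : ℂ) 1))
    (i := i) h
  rw [← Measure.restrict_pi_pi, ← volume_pi] at h2
  -- The image of `volume` in `Fin d → ℂ` is a Haar measure, hence a multiple of Lebesgue measure.
  let L : EuclideanSpace ℂ (Fin d) ≃L[ℝ] (Fin d → ℂ) :=
    PiLp.continuousLinearEquiv 2 ℝ (fun _ : Fin d ↦ ℂ)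
  have : (Measure.map L (volume : Measure (EuclideanSpace ℂ (Fin d)))).IsAddHaarMeasure :=
    L.isAddHaarMeasure_map _
  have hν := Measure.isAddLeftInvariant_eq_smul
    (Measure.map L (volume : Measure (EuclideanSpace ℂ (Fin d)))) volume
  have h3 : IntegrableOn (fun x : Fin d → ℂ ↦ Real.log ‖x i‖)
      (Set.univ.pi fun _ ↦ Metric.ball 0 1)
      (Measure.map L (volume : Measure (EuclideanSpace ℂ (Fin d)))) := by
    rw [hν, IntegrableOn, Measure.restrict_smul]
    exact h2.smul_measure_nnreal
  have hL : MeasurableEmbedding L := L.toHomeomorph.measurableEmbedding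
  rw [hL.integrableOn_map_iff] at h3
  refine h3.mono_set fun x hx ↦ ?_
  simp only [Set.mem_preimage, Set.mem_univ_pi, mem_ball_zero_iff] at hx ⊢
  exact fun j ↦ (PiLp.norm_apply_le x j).trans_lt hx

lemma integrable_log_norm_inner [NeZero d] (s : 𝕊 d) :
    Integrable (fun x : 𝕊 d ↦
      Real.log ‖inner ℂ (x : EuclideanSpace ℂ (Fin d)) (s : EuclideanSpace ℂ (Fin d))‖)
      (normalizedSurfaceMeasure d) := by
  let t : 𝕊 d := ⟨EuclideanSpace.single 0 1, by simp⟩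
  have ht (x : EuclideanSpace ℂ (Fin d)) :
      ‖inner ℂ x (t : EuclideanSpace ℂ (Fin d))‖ = ‖x 0‖ := by
    simp [t, EuclideanSpace.inner_single_right]
  suffices h : Integrable (fun x : 𝕊 d ↦ Real.log ‖(x : EuclideanSpace ℂ (Fin d)) 0‖)
      (normalizedSurfaceMeasure d) by
    obtain ⟨T, hT, hT', hTi⟩ := exists_measurePreserving_inner_eq s t
    have := (hT'.integrable_comp_emb hT).2 h
    refine this.congr (ae_of_all _ fun x ↦ ?_)
    simp only [Function.comp_apply, ← ht, hTi]
  refine Integrable.smul_measure ?_ (ENNReal.inv_ne_top.2 ?_)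
  · refine integrable_toSphere_of_integrableOn_ball volume
      (g := fun x : EuclideanSpace ℂ (Fin d) ↦ Real.log (‖x 0‖ / ‖x‖)) ?_ fun x ↦ ?_
    · refine ((integrableOn_log_norm_coord_ball (0 : Fin d)).norm.add
        (integrableOn_log_norm_ball volume).norm).mono' ?_ (ae_of_all _ fun x ↦ ?_)
      · exact (Real.measurable_log.comp (by fun_prop)).aestronglyMeasurable
      -- When `x 0 = 0` the left-hand side is `log 0 = 0`, so no exceptional set is needed.
      · rcases eq_or_ne (x 0) 0 with h | h
        · simp [h]
        · have hx : x ≠ 0 := fun hx ↦ h (by simp [hx])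
          rw [Real.log_div (norm_ne_zero_iff.2 h) (norm_ne_zero_iff.2 hx)]
          exact norm_sub_le _ _
    · simp [homeomorphUnitSphereProd, div_eq_inv_mul]
  · rw [Measure.measure_univ_ne_zero]
    exact Measure.toSphere_ne_zero _

/-! ### The truncated logarithmic kernel -/

lemma norm_inner_le_one (x s : 𝕊 d) :
    ‖inner ℂ (x : EuclideanSpace ℂ (Fin d)) (s : EuclideanSpace ℂ (Fin d))‖ ≤ 1 := by
  simpa using norm_inner_le_norm (𝕜 := ℂ) (x : EuclideanSpace ℂ (Fin d)) s

/-- The truncations `log (max |⟨x, s⟩| δ)` have means arbitrarily close to `L(d, ℂ)`. -/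
lemma exists_integral_log_max_lt [NeZero d] (s : 𝕊 d) {a : ℝ} (ha : sphereLogMean d s < a) :
    ∃ δ > 0, ∫ x : 𝕊 d, Real.log (max ‖inner ℂ (x : EuclideanSpace ℂ (Fin d))
      (s : EuclideanSpace ℂ (Fin d))‖ δ) ∂(normalizedSurfaceMeasure d) < a := by
  have hlim : Tendsto (fun n : ℕ ↦ ∫ x : 𝕊 d, Real.log (max ‖inner ℂ
      (x : EuclideanSpace ℂ (Fin d)) (s : EuclideanSpace ℂ (Fin d))‖ (1 / ((n : ℝ) + 1)))
      ∂(normalizedSurfaceMeasure d)) atTop (𝓝 (sphereLogMean d s)) := by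
    -- The modulus of the truncated logarithm is at most `|log|`, because the kernel is at most `1`.
    refine tendsto_integral_of_dominated_convergence _ (fun n ↦ ?_)
      (integrable_log_norm_inner s).norm (fun n ↦ ?_) ?_
    · exact (Real.measurable_log.comp (by fun_prop)).aestronglyMeasurable
    · filter_upwards [ae_inner_ne_zero s] with x hx
      have hpos := norm_pos_iff.2 hx
      have h1 : max ‖inner ℂ (x : EuclideanSpace ℂ (Fin d)) (s : EuclideanSpace ℂ (Fin d))‖
          (1 / ((n : ℝ) + 1)) ≤ 1 :=
        max_le (norm_inner_le_one x s) ((div_le_one (by positivity)).2 (by simp))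
      rw [Real.norm_of_nonpos (Real.log_nonpos (by positivity) h1),
        Real.norm_of_nonpos (Real.log_nonpos hpos.le (norm_inner_le_one x s))]
      exact neg_le_neg (Real.log_le_log hpos (le_max_left _ _))
    · filter_upwards [ae_inner_ne_zero s] with x hx
      have hpos := norm_pos_iff.2 hx
      refine (Real.continuousAt_log hpos.ne').tendsto.comp ?_
      simpa [max_eq_left hpos.le] using
        (tendsto_const_nhds (x := ‖inner ℂ (x : EuclideanSpace ℂ (Fin d))
          (s : EuclideanSpace ℂ (Fin d))‖)).max (tendsto_one_div_add_atTop_nhds_zero_nat (𝕜 := ℝ))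
  obtain ⟨n, hn⟩ := (hlim.eventually_lt_const ha).exists
  exact ⟨_, by positivity, hn⟩

/-- The truncated logarithmic kernel `(s, x) ↦ log (max |⟨x, s⟩| δ)`. -/
noncomputable def truncatedLogKernel (d : ℕ) {δ : ℝ} (hδ : 0 < δ) : C((𝕊 d) × (𝕊 d), ℝ) where
  toFun p := Real.log (max ‖inner ℂ (p.2 : EuclideanSpace ℂ (Fin d))
    (p.1 : EuclideanSpace ℂ (Fin d))‖ δ)
  continuous_toFun := Continuous.log (by fun_prop) fun _ ↦ (lt_max_of_lt_right hδ).ne'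

/-- Unit vectors `u 0, u 1, …` for which the normalized logarithm of `∏ |⟨x, u i⟩|` is
asymptotically at most `L(d, ℂ)`, uniformly in `x`. -/
lemma exists_seq_prod_norm_inner_le [NeZero d] (s : 𝕊 d) {a : ℝ} (ha : sphereLogMean d s < a) :
    ∃ u : ℕ → 𝕊 d, ∀ᶠ n : ℕ in atTop, ∀ x : 𝕊 d,
      ∏ i ∈ Finset.range n, ‖inner ℂ (x : EuclideanSpace ℂ (Fin d))
        (u i : EuclideanSpace ℂ (Fin d))‖ ≤ Real.exp (n * a) := by
  obtain ⟨δ, hδ, hint⟩ := exists_integral_log_max_lt s ha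
  obtain ⟨u, hu⟩ := exists_seq_uniform_average (normalizedSurfaceMeasure d)
    (truncatedLogKernel d hδ)
  refine ⟨u, ?_⟩
  filter_upwards [hu _ (sub_pos.2 hint), eventually_gt_atTop 0] with n hn hn0 x
  have hn0' : (0 : ℝ) < n := Nat.cast_pos.2 hn0
  have hmean : ∫ t, truncatedLogKernel d hδ (t, x) ∂(normalizedSurfaceMeasure d) =
      ∫ y : 𝕊 d, Real.log (max ‖inner ℂ (y : EuclideanSpace ℂ (Fin d))
        (s : EuclideanSpace ℂ (Fin d))‖ δ) ∂(normalizedSurfaceMeasure d) := by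
    rw [← integral_norm_inner_eq (fun r ↦ Real.log (max r δ)) x s]
    simp only [truncatedLogKernel, ContinuousMap.coe_mk, norm_inner_symm]
  have h := (abs_lt.1 (hn x)).2
  rw [hmean, sub_lt_sub_iff_right, inv_mul_lt_iff₀ hn0'] at h
  calc _ ≤ ∏ i ∈ Finset.range n, Real.exp (truncatedLogKernel d hδ (u i, x)) := by
        refine Finset.prod_le_prod (fun _ _ ↦ norm_nonneg _) fun i _ ↦ ?_
        simp only [truncatedLogKernel, ContinuousMap.coe_mk]
        rw [Real.exp_log (lt_max_of_lt_right hδ)]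
        exact le_max_left _ _
    _ = Real.exp (∑ i ∈ Finset.range n, truncatedLogKernel d hδ (u i, x)) :=
        (Real.exp_sum _ _).symm
    _ ≤ _ := Real.exp_le_exp.2 h.le

/-! ### Bounds for the polarization constants -/

/-- The Riesz representation theorem, normalized to a unit vector. -/
lemma exists_norm_apply_eq_norm_mul_norm_inner (f : StrongDual ℂ (EuclideanSpace ℂ (Fin d)))
    (hf : f ≠ 0) :
    ∃ t : 𝕊 d, ∀ x, ‖f x‖ = ‖f‖ * ‖inner ℂ x (t : EuclideanSpace ℂ (Fin d))‖ := by
  set v := (InnerProductSpace.toDual ℂ (EuclideanSpace ℂ (Fin d))).symm f with hv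
  have hvn : ‖v‖ = ‖f‖ := LinearIsometryEquiv.norm_map _ _
  have hf0 : ‖f‖ ≠ 0 := norm_ne_zero_iff.2 hf
  refine ⟨⟨((‖f‖⁻¹ : ℝ) : ℂ) • v, ?_⟩, fun x ↦ ?_⟩
  · simp [norm_smul, hvn, hf0]
  · rw [inner_smul_right, norm_mul, norm_inner_symm, hv,
      InnerProductSpace.toDual_symm_apply]
    simp [hf0]

/-- The upper bound `c_n(ℂ^d) ≤ e^{-nL}`: the logarithm of `|∏ f_j|` has mean
`∑ log ‖f_j‖ + n L` over the sphere, so its supremum is at least that. -/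
lemma nthPolarizationConstant_le [NeZero d] (s : 𝕊 d) (n : ℕ) :
    nthPolarizationConstant ℂ (EuclideanSpace ℂ (Fin d)) n ≤
      ENNReal.ofReal (Real.exp (-sphereLogMean d s)) ^ n := by
  refine sInf_le fun f ↦ ?_
  by_cases hf : ∃ j, f j = 0
  · obtain ⟨j, hj⟩ := hf
    rw [Finset.prod_eq_zero (Finset.mem_univ j) (by rw [← ofReal_norm, hj]; simp)]
    exact bot_le
  push Not at hf
  choose t ht using fun j ↦ exists_norm_apply_eq_norm_mul_norm_inner (f j) (hf j)
  set p := prodFunctionalNorm f with hp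
  -- `prodFunctionalNorm f` is in fact finite; if it were `∞` there would be nothing to prove.
  rcases eq_or_ne p ∞ with hp' | hp'
  · rw [hp', ENNReal.mul_top]
    · exact le_top
    · exact pow_ne_zero _ (by simp [Real.exp_pos])
  have hle (x : 𝕊 d) : ∏ j, ‖f j x‖ ≤ p.toReal := by
    rw [← norm_prod, ← toReal_enorm]
    exact ENNReal.toReal_mono hp' (le_iSup₂_of_le (x : EuclideanSpace ℂ (Fin d)) (by simp) le_rfl)
  have hae : ∀ᵐ x : 𝕊 d ∂(normalizedSurfaceMeasure d), ∀ j, f j x ≠ 0 := by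
    refine ae_all_iff.2 fun j ↦ ?_
    filter_upwards [ae_inner_ne_zero (t j)] with x hx
    rw [← norm_ne_zero_iff, ht]
    exact mul_ne_zero (norm_ne_zero_iff.2 (hf j)) (norm_ne_zero_iff.2 hx)
  have hp0 : 0 < p.toReal := by
    obtain ⟨x, hx⟩ := hae.exists
    exact (Finset.prod_pos fun j _ ↦ norm_pos_iff.2 (hx j)).trans_le (hle x)
  let F (j : Fin n) (x : 𝕊 d) : ℝ := Real.log ‖f j‖ + Real.log ‖inner ℂ
    (x : EuclideanSpace ℂ (Fin d)) (t j : EuclideanSpace ℂ (Fin d))‖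
  have hFi (j : Fin n) : Integrable (F j) (normalizedSurfaceMeasure d) :=
    (integrable_const _).add (integrable_log_norm_inner (t j))
  have hF (j : Fin n) : ∫ x, F j x ∂(normalizedSurfaceMeasure d) =
      Real.log ‖f j‖ + sphereLogMean d s := by
    rw [integral_add (integrable_const _) (integrable_log_norm_inner (t j)),
      integral_norm_inner_eq Real.log (t j) s]
    simp [sphereLogMean]
  have hlog : ∑ j, (Real.log ‖f j‖ + sphereLogMean d s) ≤ Real.log p.toReal := by
    have := integral_mono_ae (integrable_finsetSum Finset.univ fun j _ ↦ hFi j)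
      (integrable_const (μ := normalizedSurfaceMeasure d) (Real.log p.toReal)) (by
        filter_upwards [hae] with x hx
        have h := Real.log_le_log (Finset.prod_pos fun j _ ↦ norm_pos_iff.2 (hx j)) (hle x)
        rw [Real.log_prod fun j _ ↦ norm_ne_zero_iff.2 (hx j)] at h
        refine le_of_eq_of_le (Finset.sum_congr rfl fun j _ ↦ ?_) h
        have hj := norm_ne_zero_iff.2 (hx j)
        rw [ht] at hj ⊢
        exact (Real.log_mul (left_ne_zero_of_mul hj) (right_ne_zero_of_mul hj)).symm)
    rw [integral_finsetSum _ fun j _ ↦ hFi j] at this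
    simpa [hF] using this
  have hreal : ∏ j, ‖f j‖ ≤ Real.exp (-sphereLogMean d s) ^ n * p.toReal := by
    have h := Real.exp_le_exp.2 hlog
    rw [Real.exp_log hp0, Real.exp_sum] at h
    simp only [Real.exp_add, Finset.prod_mul_distrib, Finset.prod_const, Finset.card_univ,
      Fintype.card_fin, Real.exp_log (norm_pos_iff.2 (hf _))] at h
    rw [Real.exp_neg, inv_pow, inv_mul_eq_div, le_div_iff₀ (by positivity)]
    exact h
  calc ∏ j, ‖f j‖ₑ = ENNReal.ofReal (∏ j, ‖f j‖) := by
        rw [ENNReal.ofReal_prod_of_nonneg fun _ _ ↦ norm_nonneg _]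
        simp only [ofReal_norm]
    _ ≤ ENNReal.ofReal (Real.exp (-sphereLogMean d s) ^ n * p.toReal) :=
        ENNReal.ofReal_le_ofReal hreal
    _ = _ := by
        rw [ENNReal.ofReal_mul (by positivity), ENNReal.ofReal_toReal hp',
          ENNReal.ofReal_pow (Real.exp_pos _).le]

/-- The asymptotic lower bound, from functionals represented by an equidistributed sequence of
unit vectors. -/
lemma eventually_le_nthPolarizationConstant [NeZero d] (s : 𝕊 d) {a : ℝ}
    (ha : sphereLogMean d s < a) : ∀ᶠ n : ℕ in atTop,
      ENNReal.ofReal (Real.exp (-a)) ^ n ≤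
        nthPolarizationConstant ℂ (EuclideanSpace ℂ (Fin d)) n := by
  obtain ⟨u, hu⟩ := exists_seq_prod_norm_inner_le s ha
  filter_upwards [hu, eventually_gt_atTop 0] with n hn hn0
  refine le_sInf fun M hM ↦ ?_
  let f (j : Fin n) : StrongDual ℂ (EuclideanSpace ℂ (Fin d)) :=
    innerSL ℂ (u j : EuclideanSpace ℂ (Fin d))
  have hsph (x : 𝕊 d) : ∏ j, ‖f j x‖ ≤ Real.exp (n * a) := by
    refine le_of_eq_of_le ?_ (hn x)
    rw [Finset.prod_range fun i ↦ ‖inner ℂ (x : EuclideanSpace ℂ (Fin d))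
      (u i : EuclideanSpace ℂ (Fin d))‖]
    exact Finset.prod_congr rfl fun j _ ↦ by simp [f, norm_inner_symm]
  have hball : prodFunctionalNorm f ≤ ENNReal.ofReal (Real.exp (n * a)) := by
    refine iSup₂_le fun x hx ↦ ?_
    rw [← ofReal_norm]
    refine ENNReal.ofReal_le_ofReal ?_
    rw [norm_prod]
    rcases eq_or_ne x 0 with rfl | hx0
    · rw [Finset.prod_eq_zero (Finset.mem_univ (⟨0, hn0⟩ : Fin n)) (by simp)]
      positivity
    · have hx0' : ‖x‖ ≠ 0 := norm_ne_zero_iff.2 hx0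
      refine le_trans ?_ (hsph ⟨((‖x‖⁻¹ : ℝ) : ℂ) • x, by simp [norm_smul, hx0']⟩)
      refine Finset.prod_le_prod (fun _ _ ↦ norm_nonneg _) fun j _ ↦ ?_
      rw [map_smul, norm_smul]
      refine le_mul_of_one_le_left (norm_nonneg _) ?_
      simpa using (one_le_inv₀ (norm_pos_iff.2 hx0)).2 (by simpa using hx)
  have h1 : 1 ≤ M * ENNReal.ofReal (Real.exp (n * a)) := by
    have := hM f
    have hf (j : Fin n) : ‖f j‖ₑ = 1 := by
      rw [← ofReal_norm]
      simp [f]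
    simp only [hf, Finset.prod_const_one] at this
    exact this.trans (mul_le_mul_right hball M)
  have h2 : ENNReal.ofReal (Real.exp (-a)) ^ n = (ENNReal.ofReal (Real.exp (n * a)))⁻¹ := by
    rw [← ENNReal.ofReal_pow (Real.exp_pos _).le, ← Real.exp_nat_mul, mul_neg, Real.exp_neg,
      ENNReal.ofReal_inv_of_pos (Real.exp_pos _)]
  rw [h2]
  exact (ENNReal.inv_le_iff_le_mul (fun _ ↦ by simp [Real.exp_pos]) (by simp)).2 (by rwa [mul_comm])

end ComplexSphere

theorem mainTheorem2 (d : ℕ) (hd : 1 ≤ d)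
    (s : Metric.sphere (0 : EuclideanSpace ℂ (Fin d)) 1) :
    Integrable
      (fun x : Metric.sphere (0 : EuclideanSpace ℂ (Fin d)) 1 =>
        Real.log ‖inner ℂ (x : EuclideanSpace ℂ (Fin d)) (s : EuclideanSpace ℂ (Fin d))‖)
      (normalizedSurfaceMeasure d) ∧
    IsLinearPolarizationConstant ℂ (EuclideanSpace ℂ (Fin d))
      (ENNReal.ofReal (Real.exp (-sphereLogMean d s))) := by
  have : NeZero d := ⟨by omega⟩
  refine ⟨integrable_log_norm_inner s, ?_⟩
  have hroot {b : ℝ≥0∞} {n : ℕ} (hn : 0 < n) : (b ^ n) ^ (1 / (n : ℝ)) = b := by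
    rw [one_div, ENNReal.pow_rpow_inv_natCast hn.ne']
  refine tendsto_order.2 ⟨fun b hb ↦ ?_, fun b hb ↦ ?_⟩
  · have hcont : Tendsto (fun a : ℝ ↦ ENNReal.ofReal (Real.exp (-a))) (𝓝[>] (sphereLogMean d s))
        (𝓝 (ENNReal.ofReal (Real.exp (-sphereLogMean d s)))) :=
      (ENNReal.continuous_ofReal.comp (by fun_prop)).continuousAt.tendsto.mono_left
        nhdsWithin_le_nhds
    obtain ⟨a, hab, ha⟩ := ((hcont.eventually_const_lt hb).and self_mem_nhdsWithin).exists
    filter_upwards [eventually_le_nthPolarizationConstant s ha, eventually_gt_atTop 0]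
      with n hn hn0
    refine hab.trans_le ?_
    rw [← hroot (b := ENNReal.ofReal (Real.exp (-a))) hn0]
    exact ENNReal.rpow_le_rpow hn (by positivity)
  · filter_upwards [eventually_gt_atTop 0] with n hn0
    refine lt_of_le_of_lt ?_ hb
    rw [← hroot (b := ENNReal.ofReal (Real.exp (-sphereLogMean d s))) hn0]
    exact ENNReal.rpow_le_rpow (nthPolarizationConstant_le s n) (by positivity)
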